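/- Let $h:\overline{\mathbb Q}\to[0,\infty)$ be the absolute logarithmic Weil height. For $S\subset\overline{\mathbb Q}$ let $$\mathcal N_h(S)=\inf\{X\in[0,\infty)\;:\;\{\alpha\in S: h(\alpha)<X\}\text{ is infinite}\}\in[0,\infty],\qquad \inf\emptyset=\infty,$$ and write $\mathcal O_L$ for the ring of integers of a field $L\subset\overline{\mathbb Q}$. Let $t\ge 0$ be a real number. There exists a field $L\subset\overline{\mathbb Q}$ satisfying $$t\le\mathcal N_h(L)\le\mathcal N_h(\mathcal O_L)\le 2t.$$ More precisely, let $K\subset\overline{\mathbb Q}$ be any number field, let $(p_i)_{i\ge1}$ and $(d_i)_{i\ge1}$ be any sequences of primes such that $(p_i)$ is strictly increasing and the positive real numbers $p_i^{1/d_i}$ converge to $\exp(2t)$, and for each $i$ let $\xi_i\in\overline{\mathbb Q}$ be any root of $x^{d_i}-p_i$. Then the field $L=K(\xi_1,\xi_2,\xi_3,\ldots)$ satisfies these inequalities. -/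

import Mathlib

open Filter Topology
open scoped NNReal ENNReal NumberField

/-- The Northcott number of a set `S` with respect to `f`: the infimum in `[0, ∞]` of all
`X ∈ [0, ∞)` such that `{α ∈ S | f α < X}` is infinite, with `inf ∅ = ∞`. -/
noncomputable def northcottNumber {A : Type*} (f : A → ℝ≥0) (S : Set A) : ℝ≥0∞ :=
  sInf ((fun X : ℝ≥0 => (X : ℝ≥0∞)) '' {X : ℝ≥0 | {α : A | α ∈ S ∧ f α < X}.Infinite})

theorem absLogHeight₁_nonneg {K : Type*} [Field K] [CharZero K] (x : K) :
    0 ≤ NumberField.absLogHeight₁ x := by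
  unfold NumberField.absLogHeight₁
  apply Real.log_nonneg
  unfold NumberField.absMulHeight₁
  split_ifs with hx
  · haveI : FiniteDimensional ℚ (IntermediateField.adjoin ℚ {x}) :=
      IntermediateField.adjoin.finiteDimensional hx
    haveI : NumberField (IntermediateField.adjoin ℚ {x}) := {}
    exact Real.one_le_rpow (Height.one_le_mulHeight₁ _) (by positivity)
  · exact le_rfl

/-- The absolute logarithmic Weil height `h` on the algebraic numbers, with values in `[0, ∞)`. -/
noncomputable def weilHeight (α : AlgebraicClosure ℚ) : ℝ≥0 :=
  ⟨NumberField.absLogHeight₁ α, absLogHeight₁_nonneg α⟩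

/-- The ring of integers of a field `L` of algebraic numbers, as a set of algebraic numbers. -/
def integersIn (L : IntermediateField ℚ (AlgebraicClosure ℚ)) : Set (AlgebraicClosure ℚ) :=
  Set.range fun x : 𝓞 L => ((x : L) : AlgebraicClosure ℚ)

/-! Upper bound: each `ξ i` is an algebraic integer of height `log (p i) / d i`, which tends to
`2t`, and the `ξ i` are distinct.

Lower bound: write `L` as the union of a tower of number fields with `F(ξ)` above `F`, where `ξ ^ d
= p`. By the different, all but finitely many steps have `p` unramified in `F`, so `F(ξ)/F` is
totally ramified above `p`. Take `α` in `F(ξ)` but not in `F`. As `d` is prime, `α` has `d`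
conjugates over `F`, and total ramification forces their differences to be `p`-adically small
(`apply_conjugate_sub_le`). The product formula for their Vandermonde determinant turns this into
Silverman's inequality `log p / (2d) - log d / (d-1) ≤ h(α)` (`log_div_le_logHeight₁`).

The left side tends to `t`. Hence for `X < t` the elements of `L` of height below `X` all lie in one
fixed level of the tower, a number field, and Northcott's theorem makes them finite in number. -/

namespace NumberField
open Height Module

/-! ### Heights under extension of number fields. -/

open scoped Classical in
theorem prod_infinitePlace_eq_prod_embeddings {E : Type*} [Field E] [NumberField E]
    (x y : E) (g : ℝ → ℝ → ℝ) :
    ∏ w : InfinitePlace E, g (w x) (w y) ^ w.mult = ∏ φ : E →+* ℂ, g ‖φ x‖ ‖φ y‖ := by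
  rw [← Finset.prod_fiberwise Finset.univ (InfinitePlace.mk (K := E))]
  refine Finset.prod_congr rfl fun w _ => ?_
  rw [← InfinitePlace.card_filter_mk_eq, ← Finset.prod_const]
  refine Finset.prod_congr (by ext; simp) fun φ hφ => ?_
  rw [← (Finset.mem_filter.mp hφ).2]
  simp

open scoped Classical in
theorem prod_embeddings_algebraMap {E M : Type*} [Field E] [NumberField E] [Field M]
    [NumberField M] [Algebra E M] (x y : E) (g : ℝ → ℝ → ℝ) :
    ∏ φ : M →+* ℂ, g ‖φ (algebraMap E M x)‖ ‖φ (algebraMap E M y)‖ =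
      (∏ φ : E →+* ℂ, g ‖φ x‖ ‖φ y‖) ^ finrank E M := by
  have : FiniteDimensional E M := FiniteDimensional.right ℚ E M
  rw [← Finset.prod_pow]
  rw [← Finset.prod_fiberwise Finset.univ (fun φ : M →+* ℂ => φ.comp (algebraMap E M))]
  refine Finset.prod_congr rfl fun φ _ => ?_
  rw [Finset.prod_congr rfl (g := fun _ => g ‖φ x‖ ‖φ y‖)]
  · rw [Finset.prod_const]
    congr 1
    let := φ.toAlgebra
    have h := AlgHom.card E M ℂ
    rw [← h, ← Fintype.card_subtype]
    refine Fintype.card_congr ⟨fun ψ => ⟨ψ.1, fun r => congrArg (fun f : E →+* ℂ => f r) ψ.2⟩,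
      fun ψ => ⟨ψ.toRingHom, RingHom.ext ψ.commutes⟩, fun _ => rfl, fun _ => rfl⟩
  · intro ψ hψ
    rw [← (Finset.mem_filter.mp hψ).2]
    rfl

/-- The finite places contribute exactly the inverse norm of the ideal `(a, b)`. This reduces the
extension formula for heights to ideal norms and to counting extensions of embeddings. -/
theorem mulHeight₁_div_mul_absNorm {E : Type*} [Field E] [NumberField E] (a b : 𝓞 E) (hb : b ≠ 0) :
    mulHeight₁ ((a : E) / b) * (Ideal.span {a, b}).absNorm =
      ∏ φ : E →+* ℂ, max ‖φ a‖ ‖φ b‖ := by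
  have hne : (![(a : E), b]) ≠ 0 := fun h => hb (by simpa using congrFun h 1)
  have hne' : (![a, b]) ≠ 0 := fun h => hb (by simpa using congrFun h 1)
  have h2 := absNorm_mul_finprod_finitePlace_eq_one hne'
  have h3 (v : FinitePlace E) : (⨆ i, v ((![a, b] i : 𝓞 E) : E)) = ⨆ i, v ((![(a : E), b]) i) :=
    iSup_congr fun i => by fin_cases i <;> rfl
  have h4 : Set.range ![a, b] = {a, b} := by simp [Set.pair_comm]
  rw [h4] at h2
  simp_rw [h3] at h2
  rw [mulHeight₁_div_eq_mulHeight, mulHeight_eq hne, mul_assoc, mul_comm (finprod _), h2, mul_one]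
  rw [← prod_infinitePlace_eq_prod_embeddings (a : E) (b : E) max]
  refine Finset.prod_congr rfl fun v _ => ?_
  congr 1
  have : (fun i => v (![(a : E), b] i)) = ![v a, v b] := by ext i; fin_cases i <;> rfl
  rw [this]
  apply le_antisymm
  · exact ciSup_le fun i => by fin_cases i <;> simp
  · exact max_le (le_ciSup (Set.finite_range ![v a, v b]).bddAbove 0)
      (le_ciSup (Set.finite_range ![v a, v b]).bddAbove 1)

theorem mulHeight₁_algebraMap {E M : Type*} [Field E] [NumberField E] [Field M]
    [NumberField M] [Algebra E M] (x : E) :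
    mulHeight₁ (algebraMap E M x) = mulHeight₁ x ^ finrank E M := by
  obtain ⟨a, b, hb, rfl⟩ := IsFractionRing.div_surjective (𝓞 E) x
  have hb0 : b ≠ 0 := nonZeroDivisors.ne_zero hb
  have hb' : algebraMap (𝓞 E) (𝓞 M) b ≠ 0 := by
    simpa using hb0
  have h1 := mulHeight₁_div_mul_absNorm a b hb0
  have h2 := mulHeight₁_div_mul_absNorm (algebraMap (𝓞 E) (𝓞 M) a) _ hb'
  have hc (c : 𝓞 E) : ((algebraMap (𝓞 E) (𝓞 M) c : 𝓞 M) : M) = algebraMap E M c := rfl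
  have h3 : (Ideal.span {algebraMap (𝓞 E) (𝓞 M) a, algebraMap (𝓞 E) (𝓞 M) b}).absNorm =
      (Ideal.span {a, b}).absNorm ^ finrank E M := by
    have h := Ideal.absNorm_algebraMap (R := 𝓞 E) (S := 𝓞 M) (Ideal.span {a, b})
    rwa [Ideal.map_span, Set.image_pair, ← IsFractionRing.finrank_eq (𝓞 E) E (𝓞 M) M] at h
  simp only [hc] at h2
  rw [prod_embeddings_algebraMap (a : E) (b : E) max, ← h1, mul_pow, h3, Nat.cast_pow] at h2
  have hN : ((Ideal.span {a, b}).absNorm : ℝ) ≠ 0 := by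
    rw [Nat.cast_ne_zero, Ne, Ideal.absNorm_eq_zero_iff, Ideal.span_eq_bot]
    exact fun h => hb0 (h b (by simp))
  rw [map_div₀]
  exact mul_right_cancel₀ (pow_ne_zero _ hN) h2

theorem logHeight₁_algebraMap {E M : Type*} [Field E] [NumberField E] [Field M]
    [NumberField M] [Algebra E M] (x : E) :
    logHeight₁ (algebraMap E M x) = finrank E M * logHeight₁ x := by
  rw [logHeight₁_eq_log_mulHeight₁, mulHeight₁_algebraMap, Real.log_pow,
    logHeight₁_eq_log_mulHeight₁]

theorem mulHeight₁_ringEquiv {E M : Type*} [Field E] [NumberField E] [Field M]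
    [NumberField M] (σ : E ≃+* M) (x : E) : mulHeight₁ (σ x) = mulHeight₁ x := by
  let : Algebra E M := (σ : E →+* M).toAlgebra
  have h := mulHeight₁_algebraMap (M := M) x
  have h1 : finrank E M = 1 := by
    refine finrank_eq_one (1 : M) one_ne_zero fun w => ⟨σ.symm w, ?_⟩
    rw [Algebra.smul_def, mul_one]
    exact σ.apply_symm_apply w
  rw [h1, pow_one] at h
  exact h

theorem logHeight₁_natCast {M : Type*} [Field M] [NumberField M] (n : ℕ) [NeZero n] :
    logHeight₁ (n : M) = finrank ℚ M * Real.log n := by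
  have h := logHeight₁_algebraMap (M := M) (n : ℚ)
  rwa [map_natCast, Rat.logHeight₁_natCast] at h

end NumberField

/-! ### The absolute Weil height and Northcott finiteness in a number field. -/

section WeilHeight

open NumberField Height Module IntermediateField

theorem isIntegral_algebraicClosure (x : AlgebraicClosure ℚ) : IsIntegral ℚ x :=
  (AlgebraicClosure.isAlgebraic ℚ).isAlgebraic x |>.isIntegral

instance numberField_adjoin_simple (x : AlgebraicClosure ℚ) : NumberField ℚ⟮x⟯ where
  to_finiteDimensional := adjoin.finiteDimensional (isIntegral_algebraicClosure x)

theorem coe_weilHeight_eq (x : AlgebraicClosure ℚ) :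
    (weilHeight x : ℝ) = (finrank ℚ ℚ⟮x⟯ : ℝ)⁻¹ * logHeight₁ (AdjoinSimple.gen ℚ x) := by
  change absLogHeight₁ x = _
  rw [absLogHeight₁, absMulHeight₁, dif_pos (isIntegral_algebraicClosure x),
    Real.log_rpow (mulHeight₁_pos _), logHeight₁_eq_log_mulHeight₁]

theorem finrank_mul_weilHeight (M : IntermediateField ℚ (AlgebraicClosure ℚ)) [NumberField M]
    (x : M) : finrank ℚ M * (weilHeight x : ℝ) = logHeight₁ x := by
  have hle : ℚ⟮(x : AlgebraicClosure ℚ)⟯ ≤ M := adjoin_simple_le_iff.mpr x.2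
  let : Algebra ℚ⟮(x : AlgebraicClosure ℚ)⟯ M := (inclusion hle).toRingHom.toAlgebra
  have h := logHeight₁_algebraMap (M := M) (AdjoinSimple.gen ℚ (x : AlgebraicClosure ℚ))
  have h1 : algebraMap ℚ⟮(x : AlgebraicClosure ℚ)⟯ M (AdjoinSimple.gen ℚ _) = x := rfl
  have h2 : finrank ℚ ℚ⟮(x : AlgebraicClosure ℚ)⟯ * finrank ℚ⟮(x : AlgebraicClosure ℚ)⟯ M =
      finrank ℚ M := finrank_mul_finrank _ _ _
  have h3 : (finrank ℚ ℚ⟮(x : AlgebraicClosure ℚ)⟯ : ℝ) ≠ 0 :=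
    Nat.cast_ne_zero.mpr finrank_pos.ne'
  rw [h1] at h
  rw [h, ← h2, coe_weilHeight_eq]
  push_cast
  field_simp

theorem weilHeight_of_pow_eq_natCast {x : AlgebraicClosure ℚ} {d n : ℕ} (hd : d ≠ 0)
    (hn : n ≠ 0) (h : x ^ d = n) : (weilHeight x : ℝ) = Real.log n / d := by
  have : NeZero n := ⟨hn⟩
  have h1 : (AdjoinSimple.gen ℚ x) ^ d = (n : ℚ⟮x⟯) := Subtype.ext (by simpa using h)
  have h2 := congrArg logHeight₁ h1
  rw [logHeight₁_pow, logHeight₁_natCast] at h2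
  have h3 : (finrank ℚ ℚ⟮x⟯ : ℝ) ≠ 0 := Nat.cast_ne_zero.mpr finrank_pos.ne'
  have h4 : (d : ℝ) ≠ 0 := Nat.cast_ne_zero.mpr hd
  rw [coe_weilHeight_eq]
  field_simp
  linarith

theorem finite_setOf_weilHeight_lt (M : IntermediateField ℚ (AlgebraicClosure ℚ))
    [FiniteDimensional ℚ M] (X : ℝ≥0) : {x | x ∈ M ∧ weilHeight x < X}.Finite := by
  have : NumberField M := {}
  refine ((finite_setOfPred_logHeight₁_le M (finrank ℚ M * X)).image
    (fun y : M => (y : AlgebraicClosure ℚ))).subset ?_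
  rintro x ⟨hx, hX⟩
  refine ⟨⟨x, hx⟩, ?_, rfl⟩
  change logHeight₁ _ ≤ _
  rw [← finrank_mul_weilHeight]
  have : (weilHeight x : ℝ) < X := hX
  gcongr

end WeilHeight

/-! ### Ultrametric estimates for polynomials in a ramified element. -/

namespace AbsoluteValue

variable {M : Type*} [Field M] {v : AbsoluteValue M ℝ}

theorem apply_term_eq_zpow {ρ : ℝ} (hρ0 : 0 < ρ) {d : ℕ} {a y : M} (hy : v y = ρ) {n : ℤ}
    (ha : v a = (ρ ^ d) ^ n) (k : ℕ) : v (a * y ^ k) = ρ ^ (d * n + k : ℤ) := by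
  rw [map_mul, map_pow, hy, ha, zpow_add₀ hρ0.ne', zpow_mul, zpow_natCast, zpow_natCast]

/-- The nonzero terms have absolute values `ρ ^ (d * n + k)` with exponents distinct modulo `d`,
hence pairwise different. The largest term is therefore unique and equals the sum in absolute value.
-/
theorem apply_term_le_apply_sum (hv : IsNonarchimedean v) {ρ : ℝ} (hρ0 : 0 < ρ) (hρ1 : ρ < 1)
    {d : ℕ} {a : ℕ → M} {y : M} (hy : v y = ρ)
    (ha : ∀ k, a k = 0 ∨ ∃ n : ℤ, v (a k) = (ρ ^ d) ^ n) {k : ℕ} (hk : k < d) :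
    v (a k * y ^ k) ≤ v (∑ j ∈ Finset.range d, a j * y ^ j) := by
  obtain ⟨k₀, hk₀, hmax⟩ := Finset.exists_max_image (Finset.range d) (fun j => v (a j * y ^ j))
    ⟨k, Finset.mem_range.mpr hk⟩
  refine (hmax k (Finset.mem_range.mpr hk)).trans ?_
  rcases ha k₀ with h0 | ⟨n₀, hn₀⟩
  · simp [h0]
  refine (IsNonarchimedean.apply_sum_eq_of_lt hv (fun x => (v.map_neg x).symm)
    (l := fun j => a j * y ^ j) hk₀ ?_).ge
  intro j hj hjk
  refine lt_of_le_of_ne (hmax j hj) fun heq => hjk ?_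
  have h0 : 0 < v (a k₀ * y ^ k₀) := by
    rw [apply_term_eq_zpow hρ0 hy hn₀]; positivity
  rcases ha j with h | ⟨n, hn⟩
  · simp only [h, zero_mul, map_zero] at heq
    exact absurd heq h0.ne
  rw [apply_term_eq_zpow hρ0 hy hn, apply_term_eq_zpow hρ0 hy hn₀] at heq
  have h := zpow_right_injective₀ hρ0 hρ1.ne heq
  have hj := Finset.mem_range.mp hj
  have hk₀ := Finset.mem_range.mp hk₀
  have h1 : (d : ℤ) * (n - n₀) = k₀ - j := by linarith
  have h2 : n - n₀ = 0 := by
    by_contra hne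
    have : (d : ℤ) ≤ |(d : ℤ) * (n - n₀)| := by
      rw [abs_mul, Nat.abs_cast]
      exact le_mul_of_one_le_right (by positivity) (Int.one_le_abs hne)
    rw [h1, le_abs] at this
    omega
  rw [h2] at h1
  omega

/-- The constant terms cancel, and every other term has exponent prime to the value `0`, being
nonzero modulo `d`. A positive exponent gives the factor `ρ` at once; a negative one is absorbed
because the term is also bounded by both maxima. -/
theorem apply_sum_sub_apply_sum_le (hv : IsNonarchimedean v) {ρ : ℝ} (hρ0 : 0 < ρ)
    (hρ1 : ρ < 1) {d : ℕ} {a : ℕ → M} {y z : M} (hy : v y = ρ) (hz : v z = ρ)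
    (ha : ∀ k, a k = 0 ∨ ∃ n : ℤ, v (a k) = (ρ ^ d) ^ n) :
    v (∑ j ∈ Finset.range d, a j * y ^ j - ∑ j ∈ Finset.range d, a j * z ^ j) ≤
      ρ * (max (v (∑ j ∈ Finset.range d, a j * y ^ j)) 1 *
        max (v (∑ j ∈ Finset.range d, a j * z ^ j)) 1) := by
  set A := max (v (∑ j ∈ Finset.range d, a j * y ^ j)) 1 with hA
  set B := max (v (∑ j ∈ Finset.range d, a j * z ^ j)) 1 with hB
  have hA1 : 1 ≤ A := le_max_right _ _
  have hB1 : 1 ≤ B := le_max_right _ _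
  have hAB : 1 ≤ A * B := one_le_mul_of_one_le_of_one_le hA1 hB1
  rcases Nat.eq_zero_or_pos d with rfl | hd
  · simpa using by positivity
  rw [← Finset.sum_sub_distrib]
  obtain ⟨k, hk, hle⟩ := hv.finset_image_add_of_nonempty (fun j => a j * y ^ j - a j * z ^ j)
    (Finset.nonempty_range_iff.mpr hd.ne')
  refine hle.trans ?_
  rcases ha k with h | ⟨n, hn⟩
  · simp only [h, zero_mul, sub_zero, map_zero]; positivity
  have hkd := Finset.mem_range.mp hk
  rcases Nat.eq_zero_or_pos k with rfl | hk0
  · simp only [pow_zero, sub_self, map_zero]; positivity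
  have h1 := apply_term_eq_zpow hρ0 hy hn k
  have h2 := apply_term_eq_zpow hρ0 hz hn k
  have hyA : ρ ^ (d * n + k : ℤ) ≤ A :=
    h1 ▸ (apply_term_le_apply_sum hv hρ0 hρ1 hy ha hkd).trans (le_max_left _ _)
  have hzB : ρ ^ (d * n + k : ℤ) ≤ B :=
    h2 ▸ (apply_term_le_apply_sum hv hρ0 hρ1 hz ha hkd).trans (le_max_left _ _)
  have h3 : v (a k * y ^ k - a k * z ^ k) ≤ ρ ^ (d * n + k : ℤ) := by
    rw [sub_eq_add_neg]
    refine (hv _ _).trans ?_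
    rw [v.map_neg, h1, h2, max_self]
  refine h3.trans ?_
  have hne : (d * n + k : ℤ) ≠ 0 := by
    intro h
    have : (d : ℤ) ∣ k := ⟨-n, by linarith⟩
    exact absurd (Nat.le_of_dvd hk0 (Int.natCast_dvd_natCast.mp this)) (by omega)
  rcases lt_or_gt_of_ne hne with hneg | hpos
  -- For an integer `e ≤ -1` one has `1 + 2e ≤ e`, which frees one factor `ρ`.
  · calc ρ ^ (d * n + k : ℤ) ≤ ρ ^ (1 + (d * n + k) + (d * n + k) : ℤ) :=
          zpow_le_zpow_right_of_le_one₀ hρ0 hρ1.le (by omega)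
      _ = ρ * (ρ ^ (d * n + k : ℤ) * ρ ^ (d * n + k : ℤ)) := by
          rw [zpow_add₀ hρ0.ne', zpow_add₀ hρ0.ne', zpow_one, mul_assoc]
      _ ≤ ρ * (A * B) := by gcongr
  · calc ρ ^ (d * n + k : ℤ) ≤ ρ ^ (1 : ℤ) :=
          zpow_le_zpow_right_of_le_one₀ hρ0 hρ1.le (by omega)
      _ = ρ * 1 := by simp
      _ ≤ ρ * (A * B) := by gcongr

end AbsoluteValue

/-! ### Local bounds for Vandermonde determinants. -/

namespace Matrix
open scoped Nat

theorem abv_det_vandermonde_le {R : Type*} [CommRing R] [Nontrivial R] (v : AbsoluteValue R ℝ)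
    {m : ℕ} (x : Fin m → R) :
    v (vandermonde x).det ≤ m ! * ∏ i, max (v (x i)) 1 ^ (m - 1) := by
  have := v.isAbsoluteValue
  rw [← det_transpose, det_apply]
  calc v (∑ σ : Equiv.Perm (Fin m), Equiv.Perm.sign σ • ∏ i, (vandermonde x)ᵀ (σ i) i)
      ≤ ∑ σ : Equiv.Perm (Fin m), v (Equiv.Perm.sign σ • ∏ i, (vandermonde x)ᵀ (σ i) i) :=
        v.sum_le _ _
    _ = ∑ σ : Equiv.Perm (Fin m), ∏ i, v (x i) ^ (σ i : ℕ) := by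
        refine Finset.sum_congr rfl fun σ _ => ?_
        rw [v.map_units_int_smul, v.map_prod]
        simp [vandermonde]
    _ ≤ ∑ _σ : Equiv.Perm (Fin m), ∏ i, max (v (x i)) 1 ^ (m - 1) := by
        refine Finset.sum_le_sum fun σ _ => Finset.prod_le_prod (fun i _ => by positivity)
          fun i _ => ?_
        calc v (x i) ^ (σ i : ℕ) ≤ max (v (x i)) 1 ^ (σ i : ℕ) := by
              gcongr
              exact le_max_left _ _
          _ ≤ _ := pow_le_pow_right₀ (le_max_right _ _) (by have := (σ i).2; omega)
    _ = _ := by simp [Fintype.card_perm]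

/-- Squaring replaces the pairs `i < j` by ordered pairs `i ≠ j`: `r` then occurs `m * (m - 1)`
times, and each `x i` in `m - 1` pairs. -/
theorem abv_det_vandermonde_pow_le {R : Type*} [CommRing R] [IsDomain R]
    (v : AbsoluteValue R ℝ) {m d : ℕ} (x : Fin m → R) {r : ℝ}
    (h : ∀ i j, i ≠ j →
      v (x i - x j) ^ d ≤ r * (max (v (x i)) 1 * max (v (x j)) 1) ^ d) :
    v (vandermonde x).det ^ (2 * d) ≤
      r ^ (m * (m - 1)) * ∏ i, max (v (x i)) 1 ^ (2 * d * (m - 1)) := by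
  rw [det_vandermonde, v.map_prod]
  simp_rw [v.map_prod]
  rw [mul_comm 2 d, pow_mul, ← Finset.prod_pow, ← Finset.prod_pow]
  simp_rw [← Finset.prod_pow]
  calc ∏ i, ∏ j ∈ Finset.Ioi i, (v (x j - x i) ^ d) ^ 2
      ≤ ∏ i, ∏ j ∈ Finset.Ioi i,
        ((r * max (v (x i)) 1 ^ (2 * d)) * (r * max (v (x j)) 1 ^ (2 * d))) := by
        refine Finset.prod_le_prod (fun i _ => Finset.prod_nonneg fun j _ => by positivity)
          fun i _ => Finset.prod_le_prod (fun j _ => by positivity) fun j hj => ?_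
        have h1 := h j i (Finset.mem_Ioi.mp hj).ne'
        have h0 := v.nonneg (x j - x i)
        calc (v (x j - x i) ^ d) ^ 2
            ≤ (r * (max (v (x j)) 1 * max (v (x i)) 1) ^ d) ^ 2 := by gcongr
          _ = _ := by ring
    _ = ∏ i, ∏ _j ∈ {i}ᶜ, (r * max (v (x i)) 1 ^ (2 * d)) := by
        rw [Finset.prod_prod_Ioi_mul_eq_prod_prod_off_diag
          (fun _ i => r * max (v (x i)) 1 ^ (2 * d))]
    _ = _ := by
        simp only [Finset.prod_const, Finset.card_compl, Fintype.card_fin, Finset.card_singleton,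
          mul_pow, Finset.prod_mul_distrib, Finset.card_univ, ← pow_mul]
        ring_nf

end Matrix

/-! ### Silverman's inequality from the product formula. -/

namespace NumberField
open Height Module Polynomial
open scoped Nat

variable {M : Type*} [Field M] [NumberField M]

theorem FinitePlace.hasFiniteMulSupport_max_one (x : M) :
    (fun v : FinitePlace M => max (v x) 1).HasFiniteMulSupport := by
  rcases eq_or_ne x 0 with rfl | hx
  · simp [Function.HasFiniteMulSupport]
  · exact (hasFiniteMulSupport hx).max Function.hasFiniteMulSupport_fun_one

theorem mulHeight₁_pow_eq_prod_mul_finprod (x : M) (n : ℕ) :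
    mulHeight₁ x ^ n = (∏ w : InfinitePlace M, (max (w x) 1 ^ n) ^ w.mult) *
      ∏ᶠ v : FinitePlace M, max (v x) 1 ^ n := by
  rw [mulHeight₁_eq, mul_pow, ← Finset.prod_pow,
    finprod_pow (FinitePlace.hasFiniteMulSupport_max_one x)]
  simp_rw [← pow_mul, mul_comm n]

theorem FinitePlace.finprod_natCast {p : ℕ} (hp : p ≠ 0) :
    ∏ᶠ v : FinitePlace M, v (p : M) = ((p : ℝ) ^ finrank ℚ M)⁻¹ := by
  rw [FinitePlace.prod_eq_inv_abs_norm (Nat.cast_ne_zero.mpr hp)]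
  have : (p : M) = algebraMap ℚ M p := (map_natCast _ p).symm
  rw [this, Algebra.norm_algebraMap]
  simp

theorem FinitePlace.exists_natCast_lt_one {p : ℕ} (hp : 1 < p) :
    ∃ v : FinitePlace M, v (p : M) < 1 := by
  by_contra! h
  have h1 (v : FinitePlace M) : v (p : M) = 1 :=
    le_antisymm (IsNonarchimedean.apply_natCast_le_one (FinitePlace.add_le v)) (h v)
  have h2 := FinitePlace.finprod_natCast (M := M) (by omega : p ≠ 0)
  simp_rw [h1, finprod_one] at h2
  have h3 : (1 : ℝ) < (p : ℝ) ^ finrank ℚ M :=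
    one_lt_pow₀ (by exact_mod_cast hp) finrank_pos.ne'
  exact absurd h2 (inv_lt_one_of_one_lt₀ h3).ne'

/-- The product formula for the Vandermonde determinant, raised to the power `2 * d`, is bounded
place by place. Leibniz expansion at the infinite places costs the factorial; the hypothesis at the
finite places gains the power of `p`. -/
theorem pow_le_of_conjugates {m d p : ℕ} (hp : p ≠ 0) (x : Fin m → M)
    (hx : Function.Injective x)
    (h : ∀ v : FinitePlace M, ∀ i j, i ≠ j →
      v (x i - x j) ^ d ≤ v (p : M) * (max (v (x i)) 1 * max (v (x j)) 1) ^ d) :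
    (p : ℝ) ^ (finrank ℚ M * (m * (m - 1))) ≤
      (m ! : ℝ) ^ (2 * d * finrank ℚ M) * ∏ i, mulHeight₁ (x i) ^ (2 * d * (m - 1)) := by
  set V := (Matrix.vandermonde x).det with hV
  have hV0 : V ≠ 0 := Matrix.det_vandermonde_ne_zero_iff.mpr hx
  have hp0 : (p : M) ≠ 0 := Nat.cast_ne_zero.mpr hp
  have hpR : (0 : ℝ) < p := by positivity
  have hprod := congrArg (· ^ (2 * d)) (prod_abs_eq_one hV0)
  simp only [mul_pow, one_pow] at hprod
  rw [finprod_pow (FinitePlace.hasFiniteMulSupport hV0), ← Finset.prod_pow] at hprod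
  set e := 2 * d * (m - 1) with he
  have hinf : ∏ w : InfinitePlace M, (w V ^ w.mult) ^ (2 * d) ≤
      (m ! : ℝ) ^ (2 * d * finrank ℚ M) *
        ∏ i, ∏ w : InfinitePlace M, (max (w (x i)) 1 ^ e) ^ w.mult := by
    rw [Finset.prod_comm, ← InfinitePlace.sum_mult_eq, Finset.mul_sum, ← Finset.prod_pow_eq_pow_sum,
      ← Finset.prod_mul_distrib]
    refine Finset.prod_le_prod (fun _ _ => by positivity) fun w _ => ?_
    have h1 : w V ≤ _ := Matrix.abv_det_vandermonde_le w.1 x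
    calc (w V ^ w.mult) ^ (2 * d) = (w V ^ (2 * d)) ^ w.mult := by
          rw [← pow_mul, ← pow_mul, mul_comm]
      _ ≤ ((m ! * ∏ i, max (w (x i)) 1 ^ (m - 1)) ^ (2 * d)) ^ w.mult := by
          gcongr
          exact h1
      _ = _ := by
          rw [Finset.prod_pow, Finset.prod_pow, Finset.prod_pow, ← pow_mul]
          rw [mul_pow, ← pow_mul, ← pow_mul, he]
          ring
  have hfin : ∏ᶠ v : FinitePlace M, v V ^ (2 * d) ≤
      ((p : ℝ) ^ (finrank ℚ M * (m * (m - 1))))⁻¹ *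
        ∏ i, ∏ᶠ v : FinitePlace M, max (v (x i)) 1 ^ e := by
    have hf1 (i) : (fun v : FinitePlace M => max (v (x i)) 1 ^ e).HasFiniteMulSupport :=
      (FinitePlace.hasFiniteMulSupport_max_one (x i)).pow e
    have hf2 : (fun v : FinitePlace M => v (p : M) ^ (m * (m - 1))).HasFiniteMulSupport :=
      (FinitePlace.hasFiniteMulSupport hp0).pow _
    rw [← finprod_prod_comm _ _ fun i _ => hf1 i, pow_mul,
      ← inv_pow, ← FinitePlace.finprod_natCast hp,
      finprod_pow (FinitePlace.hasFiniteMulSupport hp0),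
      ← finprod_mul_distrib hf2 (Function.HasFiniteMulSupport.prod hf1 _)]
    refine finprod_le_finprod ((FinitePlace.hasFiniteMulSupport hV0).pow _)
      (fun v => by positivity)
      (hf2.mul (Function.HasFiniteMulSupport.prod hf1 _)) fun v => ?_
    exact Matrix.abv_det_vandermonde_pow_le v.1 x (h v)
  simp_rw [mulHeight₁_pow_eq_prod_mul_finprod, Finset.prod_mul_distrib]
  have h1 := mul_le_mul hinf hfin (finprod_nonneg fun v => by positivity) (by positivity)
  rw [hprod] at h1
  have h2 := mul_le_mul_of_nonneg_left h1 (by positivity :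
    0 ≤ (p : ℝ) ^ (finrank ℚ M * (m * (m - 1))))
  rw [mul_one] at h2
  refine h2.trans (le_of_eq ?_)
  field_simp

/-- Hypothesis `hF` expresses that `p` is unramified in `F` below `v`. All conjugates of `ξ` have
the same absolute value `ρ` with `ρ ^ d = v p`, so the ultrametric estimate applies; where `v p = 1`
the strong triangle inequality suffices. -/
theorem apply_conjugate_sub_le {F : Type*} [Field F] [Algebra F M]
    {d p : ℕ} (hp : p ≠ 0) {ξ : M} (hξ : ξ ^ d = p) (v : FinitePlace M)
    (hF : v (p : M) < 1 → ∀ a : F, a ≠ 0 → ∃ n : ℤ, v (algebraMap F M a) = v (p : M) ^ n)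
    (f : F[X]) (hf : f.natDegree < d) (σ τ : M ≃ₐ[F] M) :
    v (σ (aeval ξ f) - τ (aeval ξ f)) ^ d ≤
      v (p : M) * (max (v (σ (aeval ξ f))) 1 * max (v (τ (aeval ξ f))) 1) ^ d := by
  have hd : d ≠ 0 := by omega
  rcases (IsNonarchimedean.apply_natCast_le_one (FinitePlace.add_le v) :
    v (p : M) ≤ 1).lt_or_eq with hlt | heq
  · have hpow (σ : M ≃ₐ[F] M) : v (σ ξ) ^ d = v (p : M) := by
      rw [← map_pow, ← map_pow, hξ, map_natCast]
    have hsum (σ : M ≃ₐ[F] M) : σ (aeval ξ f) =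
        ∑ i ∈ Finset.range d, algebraMap F M (f.coeff i) * σ ξ ^ i := by
      rw [aeval_eq_sum_range' hf, map_sum]
      simp [Algebra.smul_def]
    have h0 : 0 < v (p : M) := FinitePlace.pos_iff.mpr (Nat.cast_ne_zero.mpr hp)
    have hρ0 : 0 < v (σ ξ) := by
      refine lt_of_le_of_ne (apply_nonneg v _) fun h => ?_
      rw [← hpow σ, ← h, zero_pow hd] at h0
      exact h0.false
    have hρ1 : v (σ ξ) < 1 := by
      by_contra! h
      exact (one_le_pow₀ h).not_gt (hpow σ ▸ hlt)
    have hτ : v (τ ξ) = v (σ ξ) :=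
      (pow_left_inj₀ (apply_nonneg v _) hρ0.le hd).mp ((hpow τ).trans (hpow σ).symm)
    have key := AbsoluteValue.apply_sum_sub_apply_sum_le (v := v.1) (FinitePlace.add_le v) hρ0 hρ1
      (a := fun i => algebraMap F M (f.coeff i)) (y := σ ξ) (z := τ ξ) (d := d) rfl hτ (by
        intro k
        rcases eq_or_ne (f.coeff k) 0 with h | h
        · exact Or.inl (by simp [h])
        · rw [hpow σ]
          exact Or.inr (hF hlt _ h))
    rw [← hsum σ, ← hsum τ] at key
    calc _ ≤ (v (σ ξ) * (max (v (σ (aeval ξ f))) 1 * max (v (τ (aeval ξ f))) 1)) ^ d :=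
          pow_le_pow_left₀ (apply_nonneg v _) key d
      _ = _ := by rw [mul_pow, hpow σ]
  · rw [heq, one_mul]
    refine pow_le_pow_left₀ (apply_nonneg v _) ?_ d
    rw [sub_eq_add_neg]
    refine (FinitePlace.add_le v _ _).trans ?_
    rw [map_neg_eq_map]
    set a := v (σ (aeval ξ f))
    set b := v (τ (aeval ξ f))
    have ha := le_max_left a 1
    have ha1 := le_max_right a 1
    have hb := le_max_left b 1
    have hb1 := le_max_right b 1
    exact max_le (by nlinarith) (by nlinarith)

/-- Silverman's inequality for a totally ramified Kummer extension of prime degree. -/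
theorem log_div_le_logHeight₁ {F : Type*} [Field F] [Algebra F M] [IsGalois F M]
    {d p : ℕ} (hd : d.Prime) (hp : p.Prime) {ξ α : M} (hξ : ξ ^ d = p)
    (hF : ∀ v : FinitePlace M, v (p : M) < 1 → ∀ a : F, a ≠ 0 →
      ∃ n : ℤ, v (algebraMap F M a) = v (p : M) ^ n)
    (hα : α ∈ IntermediateField.adjoin F {ξ}) (hα' : α ∉ (algebraMap F M).range) :
    Real.log p / (2 * d) - Real.log d / (d - 1) ≤ logHeight₁ α / finrank ℚ M := by
  have hirr : Irreducible (X ^ d - C (p : F)) := by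
    refine X_pow_sub_C_irreducible_of_prime hd fun b hb => ?_
    obtain ⟨v, hv⟩ := FinitePlace.exists_natCast_lt_one (M := M) hp.one_lt
    have hb0 : b ≠ 0 := by
      rintro rfl
      rw [zero_pow hd.ne_zero] at hb
      have := congrArg (algebraMap F M) hb
      rw [map_zero, map_natCast] at this
      exact hp.ne_zero (Nat.cast_eq_zero.mp this.symm)
    obtain ⟨n, hn⟩ := hF v hv b hb0
    have h0 : 0 < v (p : M) := FinitePlace.pos_iff.mpr (Nat.cast_ne_zero.mpr hp.ne_zero)
    -- If `p` were a `d`-th power in `F`, comparing valuations would give `n * d = 1`.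
    have h1 : v (p : M) ^ (n * d) = v (p : M) ^ (1 : ℤ) := by
      rw [zpow_mul, ← hn, zpow_natCast, ← map_pow, ← map_pow, hb, map_natCast, zpow_one]
    have h2 := zpow_right_injective₀ h0 hv.ne h1
    have h3 := Int.eq_one_or_neg_one_of_mul_eq_one' h2
    have := hd.two_le
    omega
  have hmonic : (X ^ d - C (p : F)).Monic := monic_X_pow_sub_C _ hd.ne_zero
  have hroot : aeval ξ (X ^ d - C (p : F)) = 0 := by simp [hξ]
  have hdeg : finrank F (IntermediateField.adjoin F {ξ}) = d := by
    rw [IntermediateField.adjoin.finrank (Algebra.IsIntegral.isIntegral ξ),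
      ← minpoly.eq_of_irreducible_of_monic hirr hroot hmonic, natDegree_X_pow_sub_C]
  obtain ⟨f, hf, rfl⟩ : ∃ f : F[X], f.natDegree < d ∧ aeval ξ f = α := by
    have h1 : α ∈ (IntermediateField.adjoin F {ξ}).toSubalgebra := hα
    rw [IntermediateField.adjoin_simple_toSubalgebra_of_isAlgebraic
      (Algebra.IsAlgebraic.isAlgebraic ξ), Algebra.adjoin_singleton_eq_range_aeval] at h1
    obtain ⟨g, hg⟩ := h1
    refine ⟨g %ₘ (X ^ d - C (p : F)), ?_, ?_⟩
    · have := natDegree_modByMonic_lt g hmonic hirr.ne_one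
      rwa [natDegree_X_pow_sub_C] at this
    · rw [aeval_modByMonic_eq_self_of_root hroot]
      exact hg
  set α := aeval ξ f with hαdef
  have hint : IsIntegral F α := Algebra.IsIntegral.isIntegral α
  -- The degree of `α` divides the prime `d` and is not `1`.
  have hm : (minpoly F α).natDegree = d := by
    rw [← IntermediateField.adjoin.finrank hint]
    have hdvd : finrank F (IntermediateField.adjoin F {α}) ∣ d :=
      hdeg ▸ IntermediateField.finrank_dvd_of_le_right
        (IntermediateField.adjoin_simple_le_iff.mpr hα)
    refine ((Nat.dvd_prime hd).mp hdvd).resolve_left fun h1 => hα' ?_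
    rw [IntermediateField.finrank_adjoin_simple_eq_one_iff] at h1
    exact IntermediateField.mem_bot.mp h1
  have hcard : Fintype.card ((minpoly F α).rootSet M) = d := by
    rw [card_rootSet_eq_natDegree (Algebra.IsSeparable.isSeparable F α)
      (Normal.splits inferInstance α), hm]
  let x : Fin d → M := fun i => ((Fintype.equivFinOfCardEq hcard).symm i : (minpoly F α).rootSet M)
  have hx : Function.Injective x :=
    Subtype.val_injective.comp (Fintype.equivFinOfCardEq hcard).symm.injective
  have hconj (i : Fin d) : ∃ σ : M ≃ₐ[F] M, σ α = x i := by
    refine minpoly.exists_algEquiv_of_root' hint.isAlgebraic ?_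
    exact aeval_eq_zero_of_mem_rootSet ((Fintype.equivFinOfCardEq hcard).symm i).2
  choose σ hσ using hconj
  have key := pow_le_of_conjugates hp.ne_zero x hx (d := d) fun v i j _ => by
    rw [← hσ i, ← hσ j]
    exact apply_conjugate_sub_le hp.ne_zero hξ v (hF v) f hf (σ i) (σ j)
  have hheight (i : Fin d) : mulHeight₁ (x i) = mulHeight₁ α := by
    rw [← hσ i]
    exact mulHeight₁_ringEquiv (σ i).toRingEquiv α
  simp_rw [hheight, Finset.prod_const, Finset.card_univ, Fintype.card_fin] at key
  have hH := mulHeight₁_pos α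
  have hd1 : (1 : ℝ) < d := by exact_mod_cast hd.one_lt
  have hD : (0 : ℝ) < finrank ℚ M := by exact_mod_cast finrank_pos
  have hp0 : (0 : ℝ) < p := by exact_mod_cast hp.pos
  have hlog := Real.log_le_log (by positivity) key
  rw [Real.log_mul (by positivity) (by positivity), Real.log_pow, Real.log_pow, Real.log_pow,
    Real.log_pow, ← logHeight₁_eq_log_mulHeight₁] at hlog
  push_cast [Nat.cast_sub hd.one_lt.le] at hlog
  -- With `d! ≤ d ^ d`, dividing by `2 * d ^ 2 * (d - 1) * [M : ℚ]` leaves the error term `log d /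
  -- (d - 1)`.
  have hfac : Real.log (d ! : ℝ) ≤ d * Real.log d := by
    rw [← Real.log_pow]
    exact Real.log_le_log (by positivity) (by exact_mod_cast Nat.factorial_le_pow d)
  have hd1' : (0 : ℝ) < d - 1 := by linarith
  rw [le_div_iff₀ hD, sub_mul, sub_le_iff_le_add, div_mul_eq_mul_div, div_mul_eq_mul_div,
    div_le_iff₀ (by positivity), add_mul, div_mul_eq_mul_div, ← sub_le_iff_le_add',
    le_div_iff₀ hd1']
  have h5 : 2 * (d : ℝ) * finrank ℚ M * Real.log (d ! : ℝ) ≤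
      2 * (d : ℝ) * finrank ℚ M * (d * Real.log d) := by gcongr
  refine le_of_mul_le_mul_left ?_ (by linarith : (0 : ℝ) < d)
  nlinarith

end NumberField

/-! ### Ramification controlled by integers in the different. -/

namespace NumberField
open Module Polynomial

section
variable {F M : Type*} [Field F] [NumberField F] [Field M] [NumberField M] [Algebra F M]

/-- If `p` is unramified in `F`, then every element of a prime of `F` above `p` becomes divisible
by `p` after multiplication by a suitable element outside that prime. -/
theorem exists_notMem_forall_dvd_mul {p : ℕ} {N : ℤ} (hp : p.Prime) (hpN : ¬ (p : ℤ) ∣ N)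
    (hN : (N : 𝓞 F) ∈ differentIdeal ℤ (𝓞 F)) (P : Ideal (𝓞 F)) [hP : P.IsPrime]
    (hpP : (p : 𝓞 F) ∈ P) : ∃ j ∉ P, ∀ a ∈ P, (p : 𝓞 F) ∣ a * j := by
  have hPdvd : P ∣ Ideal.span {(p : 𝓞 F)} := by
    rwa [Ideal.dvd_span_singleton]
  obtain ⟨Q, hQ⟩ := hPdvd
  have hpZ : Prime (p : ℤ) := Nat.prime_iff_prime_int.mp hp
  have hnot : ¬ Q ≤ P := by
    intro hle
    obtain ⟨R, rfl⟩ := Ideal.dvd_iff_le.mpr hle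
    have hmax : (Ideal.span {(p : ℤ)}).IsMaximal :=
      PrincipalIdealRing.isMaximal_of_irreducible hpZ.irreducible
    -- If `P ^ 2` divided `p`, then `P` would divide the different and contain both `N` and `p`,
    -- which are coprime.
    have hsq : P ^ 2 ∣ (Ideal.span {(p : ℤ)}).map (algebraMap ℤ (𝓞 F)) := by
      rw [Ideal.map_span, Set.image_singleton, map_natCast, hQ]
      exact ⟨R, by ring⟩
    have hdvd := pow_sub_one_dvd_differentIdeal ℤ P 2
      (by simpa using hp.ne_zero) hsq
    rw [Nat.add_one_sub_one, pow_one, Ideal.dvd_iff_le] at hdvd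
    have hNP := hdvd hN
    obtain ⟨u, w, huw⟩ := (hpZ.coprime_iff_not_dvd).mpr hpN
    refine hP.ne_top ((Ideal.eq_top_iff_one P).mpr ?_)
    have h1 : ((u * p + w * N : ℤ) : 𝓞 F) ∈ P := by
      push_cast
      exact P.add_mem (P.mul_mem_left _ hpP) (P.mul_mem_left _ hNP)
    rwa [huw, Int.cast_one] at h1
  obtain ⟨j, hjQ, hjP⟩ := Set.not_subset.mp hnot
  refine ⟨j, hjP, fun a ha => ?_⟩
  rw [← Ideal.mem_span_singleton, hQ]
  exact Ideal.mul_mem_mul ha hjQ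

theorem FinitePlace.apply_lt_one_iff_mem (v : FinitePlace M) (x : 𝓞 M) :
    v (x : M) < 1 ↔ x ∈ v.maximalIdeal.asIdeal := by
  rw [← FinitePlace.norm_embedding_eq]
  exact FinitePlace.norm_lt_one_iff_mem M _ x

theorem FinitePlace.apply_le_one (v : FinitePlace M) (x : 𝓞 M) : v (x : M) ≤ 1 := by
  rw [← FinitePlace.norm_embedding_eq]
  exact FinitePlace.norm_le_one M _ x

/-- An integral element lying in the prime below `v` can be divided by `p` up to a factor of
absolute value `1`. Repeating this must stop, since each division uses up one power of `v p`;
fractions follow. -/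
theorem exists_apply_eq_zpow {p : ℕ} {N : ℤ} (hp : p.Prime) (hpN : ¬ (p : ℤ) ∣ N)
    (hN : (N : 𝓞 F) ∈ differentIdeal ℤ (𝓞 F)) (v : FinitePlace M) (hv : v (p : M) < 1)
    (a : F) (ha : a ≠ 0) : ∃ n : ℤ, v (algebraMap F M a) = v (p : M) ^ n := by
  let P : Ideal (𝓞 F) := v.maximalIdeal.asIdeal.comap (algebraMap (𝓞 F) (𝓞 M))
  have hPrime : P.IsPrime := Ideal.comap_isPrime _ _
  have hmem (x : 𝓞 F) : x ∈ P ↔ v (algebraMap F M x) < 1 :=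
    (v.apply_lt_one_iff_mem (algebraMap (𝓞 F) (𝓞 M) x)).symm
  have hle (x : 𝓞 F) : v (algebraMap F M x) ≤ 1 := v.apply_le_one (algebraMap (𝓞 F) (𝓞 M) x)
  have hpP : (p : 𝓞 F) ∈ P := by
    rw [hmem]
    simpa using hv
  have hp0 : 0 < v (p : M) := FinitePlace.pos_iff.mpr (Nat.cast_ne_zero.mpr hp.ne_zero)
  obtain ⟨j, hjP, hj⟩ := exists_notMem_forall_dvd_mul hp hpN hN P hpP
  have hj1 : v (algebraMap F M j) = 1 :=
    le_antisymm (hle j) (not_lt.mp fun h => hjP ((hmem j).mpr h))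
  have key (k : ℕ) : ∀ x : 𝓞 F, v (p : M) ^ k < v (algebraMap F M x) →
      ∃ n : ℕ, v (algebraMap F M x) = v (p : M) ^ n := by
    induction k with
    | zero => exact fun x hx => absurd (hle x) (by simpa using hx)
    | succ k ih =>
      intro x hx
      by_cases hxP : x ∈ P
      · obtain ⟨b, hb⟩ := hj x hxP
        have h1 : v (algebraMap F M x) = v (p : M) * v (algebraMap F M b) := by
          have := congrArg (fun y : 𝓞 F => v (algebraMap F M y)) hb
          simpa [hj1] using this
        rw [h1, pow_succ', mul_lt_mul_iff_right₀ hp0] at hx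
        obtain ⟨n, hn⟩ := ih b hx
        exact ⟨n + 1, by rw [h1, hn, pow_succ']⟩
      · exact ⟨0, by
          rw [pow_zero]
          exact le_antisymm (hle x) (not_lt.mp fun h => hxP ((hmem x).mpr h))⟩
  have key' (x : 𝓞 F) (hx : x ≠ 0) : ∃ n : ℕ, v (algebraMap F M x) = v (p : M) ^ n := by
    have h0 : 0 < v (algebraMap F M x) := FinitePlace.pos_iff.mpr (by simpa using hx)
    obtain ⟨k, hk⟩ := exists_pow_lt_of_lt_one h0 hv
    exact key k x hk
  obtain ⟨x, y, hy, rfl⟩ := IsFractionRing.div_surjective (𝓞 F) a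
  have hy0 : y ≠ 0 := nonZeroDivisors.ne_zero hy
  have hx0 : x ≠ 0 := by
    rintro rfl
    simp at ha
  obtain ⟨n, hn⟩ := key' x hx0
  obtain ⟨m, hm⟩ := key' y hy0
  refine ⟨n - m, ?_⟩
  rw [map_div₀, map_div₀, zpow_sub₀ hp0.ne', zpow_natCast, zpow_natCast, ← hn, ← hm]

end

/-- The minimal polynomial of `θ` divides `X ^ e - q`, so its derivative at `θ` divides `e * θ ^ (e
- 1)`, hence also `e * q`. Differents multiply in towers. -/
theorem intCast_mem_differentIdeal_of_pow_eq {F E : Type*} [Field F] [NumberField F] [Field E]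
    [NumberField E] [Algebra F E] {N : ℤ} (hN : (N : 𝓞 F) ∈ differentIdeal ℤ (𝓞 F))
    {θ : E} {e q : ℕ} (he : e ≠ 0) (hθ : θ ^ e = q) (htop : IntermediateField.adjoin F {θ} = ⊤) :
    ((N * (e * q) : ℤ) : 𝓞 E) ∈ differentIdeal ℤ (𝓞 E) := by
  have hint : IsIntegral ℤ θ := by
    refine IsIntegral.of_pow (Nat.pos_of_ne_zero he) ?_
    rw [hθ, ← map_natCast (algebraMap ℤ E)]
    exact isIntegral_algebraMap
  let x : 𝓞 E := ⟨θ, hint⟩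
  have hx : x ^ e = q := RingOfIntegers.ext (by
    change θ ^ e = ((q : 𝓞 E) : E)
    simpa using hθ)
  have htop' : Algebra.adjoin F {algebraMap (𝓞 E) E x} = ⊤ := by
    have : FiniteDimensional F E := FiniteDimensional.right ℚ F E
    rw [← IntermediateField.adjoin_simple_toSubalgebra_of_isAlgebraic
      (Algebra.IsAlgebraic.isAlgebraic _)]
    change (IntermediateField.adjoin F {θ}).toSubalgebra = ⊤
    rw [htop, IntermediateField.top_toSubalgebra]
  have h1 := aeval_derivative_mem_differentIdeal (𝓞 F) F E x htop'
  have h2 : ((e * q : ℤ) : 𝓞 E) ∈ differentIdeal (𝓞 F) (𝓞 E) := by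
    obtain ⟨g, hg⟩ : minpoly (𝓞 F) x ∣ X ^ e - C (q : 𝓞 F) :=
      minpoly.isIntegrallyClosed_dvd (Algebra.IsIntegral.isIntegral x) (by simp [hx])
    have h3 := congrArg (fun f => aeval x (derivative f)) hg
    simp only [map_natCast, derivative_sub, derivative_X_pow, derivative_natCast, sub_zero,
      derivative_mul, map_add, map_mul, minpoly.aeval, zero_mul, add_zero, map_pow, aeval_X] at h3
    have h4 : ((e * q : ℤ) : 𝓞 E) = aeval x (derivative (minpoly (𝓞 F) x)) * (aeval x g * x) := by
      rw [← mul_assoc, ← h3, mul_assoc, pow_sub_one_mul he, hx]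
      push_cast
      rfl
    rw [h4]
    exact Ideal.mul_mem_right _ _ h1
  rw [differentIdeal_eq_differentIdeal_mul_differentIdeal ℤ (𝓞 F) (𝓞 E)]
  have h3 := Ideal.mul_mem_mul h2 (Ideal.mem_map_of_mem (algebraMap (𝓞 F) (𝓞 E)) hN)
  convert h3 using 1
  push_cast
  rw [map_intCast]
  ring

theorem exists_intCast_mem_differentIdeal (F : Type*) [Field F] [NumberField F] :
    ∃ N : ℤ, N ≠ 0 ∧ (N : 𝓞 F) ∈ differentIdeal ℤ (𝓞 F) := by
  refine ⟨Ideal.absNorm (differentIdeal ℤ (𝓞 F)), ?_, ?_⟩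
  · rw [Nat.cast_ne_zero, Ne, Ideal.absNorm_eq_zero_iff]
    exact differentIdeal_ne_bot
  · exact_mod_cast Ideal.absNorm_mem (differentIdeal ℤ (𝓞 F))

end NumberField

/-! ### Northcott numbers and the tower of fields. -/

section NorthcottNumber

open NumberField Height Module IntermediateField

theorem northcottNumber_anti {A : Type*} (f : A → ℝ≥0) {S T : Set A} (h : S ⊆ T) :
    northcottNumber f T ≤ northcottNumber f S :=
  sInf_le_sInf (Set.image_mono fun _ hX => hX.mono fun _ hα => ⟨h hα.1, hα.2⟩)

theorem integersIn_subset (L : IntermediateField ℚ (AlgebraicClosure ℚ)) :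
    integersIn L ⊆ (L : Set (AlgebraicClosure ℚ)) := by
  rintro _ ⟨x, rfl⟩
  exact (x : L).2

theorem mem_integersIn_of_pow_eq {L : IntermediateField ℚ (AlgebraicClosure ℚ)}
    {x : AlgebraicClosure ℚ} (hx : x ∈ L) {d n : ℕ} (hd : d ≠ 0) (h : x ^ d = n) :
    x ∈ integersIn L := by
  have hint : IsIntegral ℤ (⟨x, hx⟩ : L) := by
    refine IsIntegral.of_pow (Nat.pos_of_ne_zero hd) ?_
    have : (⟨x, hx⟩ : L) ^ d = algebraMap ℤ L n := Subtype.ext (by simpa using h)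
    rw [this]
    exact isIntegral_algebraMap
  exact ⟨⟨_, hint⟩, rfl⟩

/-- Translates a compositum formed inside the algebraic closure into adjunction over `A` inside `M`.
-/
theorem mem_adjoin_of_coe_mem_sup {A M : IntermediateField ℚ (AlgebraicClosure ℚ)} [Algebra A M]
    (hA : ∀ x : A, ((algebraMap A M x : M) : AlgebraicClosure ℚ) = x) {ξ α : M}
    (hα : (α : AlgebraicClosure ℚ) ∈ A ⊔ ℚ⟮(ξ : AlgebraicClosure ℚ)⟯) : α ∈ adjoin A {ξ} := by
  have hle : A ⊔ ℚ⟮(ξ : AlgebraicClosure ℚ)⟯ ≤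
      lift ((adjoin A {ξ}).restrictScalars ℚ) := by
    refine sup_le (fun x hx => ?_) (adjoin_simple_le_iff.mpr ?_)
    · have := (mem_lift (F := M) (E := (adjoin A {ξ}).restrictScalars ℚ)
        (algebraMap A M ⟨x, hx⟩)).mpr ((adjoin A {ξ}).algebraMap_mem ⟨x, hx⟩)
      rwa [hA] at this
    · exact (mem_lift ξ).mpr (mem_adjoin_simple_self A ξ)
  exact (mem_lift α).mp (hle hα)

instance normal_algebraicClosure : Normal ℚ (AlgebraicClosure ℚ) :=
  normal_iff.mpr fun x => ⟨isIntegral_algebraicClosure x, IsAlgClosed.splits _⟩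

/-- The tower of fields `K ⊆ K(ξ₀) ⊆ K(ξ₀, ξ₁) ⊆ ⋯`. -/
noncomputable def adjoinTower (K : IntermediateField ℚ (AlgebraicClosure ℚ)) (ξ : ℕ → AlgebraicClosure ℚ) :
    ℕ → IntermediateField ℚ (AlgebraicClosure ℚ)
  | 0 => K
  | n + 1 => adjoinTower K ξ n ⊔ ℚ⟮ξ n⟯

section
variable {K : IntermediateField ℚ (AlgebraicClosure ℚ)} {ξ : ℕ → AlgebraicClosure ℚ}

theorem monotone_adjoinTower : Monotone (adjoinTower K ξ) :=
  monotone_nat_of_le_succ fun _ => le_sup_left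

theorem mem_adjoinTower_succ (n : ℕ) : ξ n ∈ adjoinTower K ξ (n + 1) :=
  (le_sup_right : ℚ⟮ξ n⟯ ≤ adjoinTower K ξ n ⊔ ℚ⟮ξ n⟯) (mem_adjoin_simple_self ℚ (ξ n))

instance finiteDimensional_adjoinTower [FiniteDimensional ℚ K] (n : ℕ) :
    FiniteDimensional ℚ (adjoinTower K ξ n) := by
  induction n with
  | zero => assumption
  | succ n ih =>
    have := adjoin.finiteDimensional (isIntegral_algebraicClosure (ξ n))
    exact IntermediateField.finiteDimensional_sup _ _

instance numberField_adjoinTower [FiniteDimensional ℚ K] (n : ℕ) :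
    NumberField (adjoinTower K ξ n) where

theorem exists_mem_adjoinTower {x : AlgebraicClosure ℚ} (hx : x ∈ adjoin K (Set.range ξ)) :
    ∃ n, x ∈ adjoinTower K ξ n := by
  induction hx using adjoin_induction with
  | mem x hx =>
    obtain ⟨i, rfl⟩ := hx
    exact ⟨i + 1, mem_adjoinTower_succ i⟩
  | algebraMap x => exact ⟨0, x.2⟩
  | add x y _ _ hx hy =>
    obtain ⟨n, hn⟩ := hx
    obtain ⟨m, hm⟩ := hy
    exact ⟨max n m, add_mem (monotone_adjoinTower (le_max_left n m) hn)
      (monotone_adjoinTower (le_max_right n m) hm)⟩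
  | inv x _ hx =>
    obtain ⟨n, hn⟩ := hx
    exact ⟨n, inv_mem hn⟩
  | mul x y _ _ hx hy =>
    obtain ⟨n, hn⟩ := hx
    obtain ⟨m, hm⟩ := hy
    exact ⟨max n m, mul_mem (monotone_adjoinTower (le_max_left n m) hn)
      (monotone_adjoinTower (le_max_right n m) hm)⟩

theorem intCast_mem_differentIdeal_adjoinTower [FiniteDimensional ℚ K] {p d : ℕ → ℕ}
    (hd : ∀ i, d i ≠ 0) (hξ : ∀ i, ξ i ^ d i = p i) {N : ℤ}
    (hN : (N : 𝓞 (adjoinTower K ξ 0)) ∈ differentIdeal ℤ (𝓞 (adjoinTower K ξ 0))) (n : ℕ) :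
    ((N * ∏ j ∈ Finset.range n, (d j * p j : ℤ) : ℤ) : 𝓞 (adjoinTower K ξ n)) ∈
      differentIdeal ℤ (𝓞 (adjoinTower K ξ n)) := by
  induction n with
  | zero => simpa using hN
  | succ n ih =>
    rw [Finset.prod_range_succ, ← mul_assoc]
    let : Algebra (adjoinTower K ξ n) (adjoinTower K ξ (n + 1)) :=
      (inclusion (monotone_adjoinTower n.le_succ)).toRingHom.toAlgebra
    refine intCast_mem_differentIdeal_of_pow_eq ih
      (θ := (⟨ξ n, mem_adjoinTower_succ n⟩ : adjoinTower K ξ (n + 1))) (hd n)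
      (Subtype.ext (by simpa using hξ n)) ?_
    rw [eq_top_iff]
    exact fun α _ => mem_adjoin_of_coe_mem_sup (fun _ => rfl) α.2

/-- The conditions on `p n` keep it from dividing the integer `N * ∏ d j * p j` in the different of
level `n`, so it is unramified there. -/
theorem log_div_le_weilHeight [FiniteDimensional ℚ K] {p d : ℕ → ℕ}
    (hp : ∀ i, (p i).Prime) (hd : ∀ i, (d i).Prime) (hξ : ∀ i, ξ i ^ d i = p i) {N : ℤ}
    (hN : (N : 𝓞 (adjoinTower K ξ 0)) ∈ differentIdeal ℤ (𝓞 (adjoinTower K ξ 0))) {n : ℕ}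
    (hpN : ¬ (p n : ℤ) ∣ N) (hpj : ∀ j < n, p n ≠ p j ∧ p n ≠ d j) {α : AlgebraicClosure ℚ}
    (hα : α ∈ adjoinTower K ξ (n + 1)) (hα' : α ∉ adjoinTower K ξ n) :
    Real.log (p n) / (2 * d n) - Real.log (d n) / (d n - 1) ≤ weilHeight α := by
  have hndvd : ¬ (p n : ℤ) ∣ N * ∏ j ∈ Finset.range n, (d j * p j : ℤ) := by
    have hprime := Nat.prime_iff_prime_int.mp (hp n)
    rw [hprime.dvd_mul, hprime.dvd_finsetProd_iff]
    rintro (h | ⟨j, hj, h⟩)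
    · exact hpN h
    · rw [← Nat.cast_mul, Int.natCast_dvd_natCast, (hp n).dvd_mul,
        Nat.prime_dvd_prime_iff_eq (hp n) (hd j), Nat.prime_dvd_prime_iff_eq (hp n) (hp j)] at h
      have := hpj j (Finset.mem_range.mp hj)
      tauto
  have hdiff := intCast_mem_differentIdeal_adjoinTower (fun i => (hd i).ne_zero) hξ hN n
  set E := adjoinTower K ξ (n + 1) with hE
  set F := adjoinTower K ξ n with hF
  -- Silverman's inequality needs a Galois extension containing the conjugates. Enlarging the field
  -- is harmless: only ramification in `F` matters, and the height is absolute.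
  let M : IntermediateField ℚ (AlgebraicClosure ℚ) := normalClosure ℚ E (AlgebraicClosure ℚ)
  have hEM : E ≤ M := E.le_normalClosure
  have hFM : F ≤ M := (monotone_adjoinTower n.le_succ).trans hEM
  have hMfin : FiniteDimensional ℚ M := normalClosure.is_finiteDimensional ℚ E _
  have : NumberField M := {}
  let : Algebra F M := (inclusion hFM).toRingHom.toAlgebra
  have hnormal : Normal ℚ M := normalClosure.normal ℚ E _
  have : Normal F M := Normal.tower_top_of_normal ℚ F M
  have : IsGalois F M := {}
  have key := log_div_le_logHeight₁ (F := F) (M := M) (hd n) (hp n)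
    (ξ := ⟨ξ n, hEM (mem_adjoinTower_succ n)⟩) (α := ⟨α, hEM hα⟩)
    (Subtype.ext (by simpa using hξ n))
    (exists_apply_eq_zpow (hp n) hndvd hdiff)
    (mem_adjoin_of_coe_mem_sup (fun _ => rfl) hα)
    (by
      rintro ⟨y, hy⟩
      have : (y : AlgebraicClosure ℚ) = α := congrArg Subtype.val hy
      exact hα' (this ▸ y.2))
  rw [← finrank_mul_weilHeight] at key
  have h0 : (finrank ℚ M : ℝ) ≠ 0 := Nat.cast_ne_zero.mpr finrank_pos.ne'
  rwa [mul_div_cancel_left₀ _ h0] at key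

end

/-! ### Asymptotics of the primes and exponents. -/

section Asymptotics
variable {t : ℝ} {p d : ℕ → ℕ}

theorem tendsto_log_div (hp : ∀ i, (p i).Prime)
    (h : Tendsto (fun i => (p i : ℝ) ^ (1 / (d i : ℝ))) atTop (𝓝 (Real.exp (2 * t)))) :
    Tendsto (fun i => Real.log (p i) / d i) atTop (𝓝 (2 * t)) := by
  have h1 := (Real.continuousAt_log (Real.exp_pos (2 * t)).ne').tendsto.comp h
  rw [Real.log_exp] at h1
  refine h1.congr fun i => ?_
  have : (0 : ℝ) < p i := by exact_mod_cast (hp i).pos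
  simp only [Function.comp_apply]
  rw [Real.log_rpow this]
  ring

theorem tendsto_atTop_of_tendsto_log_div (hmono : StrictMono p) (hd : ∀ i, (d i).Prime)
    (h : Tendsto (fun i => Real.log (p i) / d i) atTop (𝓝 (2 * t))) (ht : 0 ≤ t) :
    Tendsto (fun i => (d i : ℝ)) atTop atTop := by
  have h1 : Tendsto (fun i => Real.log (p i) / (2 * t + 1)) atTop atTop :=
    (Real.tendsto_log_atTop.comp
      (tendsto_natCast_atTop_atTop.comp hmono.tendsto_atTop)).atTop_div_const (by linarith)
  refine tendsto_atTop_mono' atTop ?_ h1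
  filter_upwards [h.eventually_le_const (by linarith : 2 * t < 2 * t + 1)] with i hi
  have : (0 : ℝ) < d i := by exact_mod_cast (hd i).pos
  rw [div_le_iff₀ (by linarith)]
  rw [div_le_iff₀ this] at hi
  linarith

/-- Eventually `t * d i ≤ log (p i) ≤ (t / 2) * p i`. Positivity of `t` is essential here. -/
theorem eventually_lt_of_tendsto_log_div (hmono : StrictMono p) (hp : ∀ i, (p i).Prime)
    (hd : ∀ i, (d i).Prime)
    (h : Tendsto (fun i => Real.log (p i) / d i) atTop (𝓝 (2 * t))) (ht : 0 < t) :
    ∀ᶠ i in atTop, d i < p i := by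
  have h1 := (Real.isLittleO_log_id_atTop.bound (by linarith : 0 < t / 2))
  have h2 := (tendsto_natCast_atTop_atTop (R := ℝ)).comp hmono.tendsto_atTop |>.eventually h1
  filter_upwards [h.eventually_const_le (by linarith : t < 2 * t), h2] with i hi hi2
  have hd0 : (0 : ℝ) < d i := by exact_mod_cast (hd i).pos
  have hp0 : (0 : ℝ) < p i := by exact_mod_cast (hp i).pos
  simp only [Function.comp_apply, id, Real.norm_natCast] at hi2
  have h3 := (le_abs_self _).trans hi2
  rw [le_div_iff₀ hd0] at hi
  have h4 : (d i : ℝ) ≤ p i / 2 := by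
    refine le_of_mul_le_mul_left ?_ ht
    linarith
  exact_mod_cast (by linarith : (d i : ℝ) < p i)

/-- The finitely many early `d j` are eventually exceeded by `p n`; for later ones `d j < p j < p
n`. -/
theorem eventually_ne_of_eventually_lt (hmono : StrictMono p) (h : ∀ᶠ i in atTop, d i < p i) :
    ∀ᶠ n in atTop, ∀ j < n, p n ≠ p j ∧ p n ≠ d j := by
  obtain ⟨j₀, hj₀⟩ := eventually_atTop.mp h
  filter_upwards [hmono.tendsto_atTop.eventually_gt_atTop ((Finset.range j₀).sup d)]
    with n hn j hj
  refine ⟨(hmono hj).ne', ?_⟩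
  rcases lt_or_ge j j₀ with hlt | hge
  · exact ((Finset.le_sup (f := d) (Finset.mem_range.mpr hlt)).trans_lt hn).ne'
  · exact ((hj₀ j hge).trans (hmono hj)).ne'

theorem eventually_le_log_div_sub (hmono : StrictMono p) (hd : ∀ i, (d i).Prime)
    (h : Tendsto (fun i => Real.log (p i) / d i) atTop (𝓝 (2 * t))) (ht : 0 ≤ t) {x : ℝ}
    (hx : x < t) :
    ∀ᶠ i in atTop, x ≤ Real.log (p i) / (2 * d i) - Real.log (d i) / (d i - 1) := by
  have hε : 0 < (t - x) / 4 := by linarith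
  have h1 := (tendsto_atTop_of_tendsto_log_div hmono hd h ht).eventually
    (Real.isLittleO_log_id_atTop.bound hε)
  filter_upwards [h.eventually_const_le (by linarith : x + t < 2 * t), h1] with i hi hi1
  have hd2 : (2 : ℝ) ≤ d i := by exact_mod_cast (hd i).two_le
  simp only [id, Real.norm_natCast] at hi1
  have h3 := (le_abs_self _).trans hi1
  have h4 : Real.log (d i) / (d i - 1) ≤ (t - x) / 2 := by
    rw [div_le_iff₀ (by linarith)]
    nlinarith
  have h5 : Real.log (p i) / (2 * d i) = Real.log (p i) / d i / 2 := by
    rw [div_div, mul_comm]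
  rw [h5]
  linarith

end Asymptotics

/-! ### The two bounds for the Northcott numbers, and suitable primes. -/

section
variable {t : ℝ} {p d : ℕ → ℕ} {ξ : ℕ → AlgebraicClosure ℚ}
  {K L : IntermediateField ℚ (AlgebraicClosure ℚ)}

theorem le_northcottNumber_adjoin [FiniteDimensional ℚ K] (ht : 0 ≤ t)
    (hp : ∀ i, (p i).Prime) (hd : ∀ i, (d i).Prime) (hmono : StrictMono p)
    (hξ : ∀ i, ξ i ^ d i = p i)
    (hlim : Tendsto (fun i => Real.log (p i) / d i) atTop (𝓝 (2 * t)))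
    (hL : ∀ x ∈ L, x ∈ adjoin K (Set.range ξ)) :
    ENNReal.ofReal t ≤ northcottNumber weilHeight (L : Set (AlgebraicClosure ℚ)) := by
  rcases ht.eq_or_lt with rfl | ht0
  · simp
  refine le_sInf ?_
  rintro _ ⟨X, hX, rfl⟩
  by_contra! hlt
  have hXt : (X : ℝ) < t := by
    rw [← ENNReal.ofReal_coe_nnreal] at hlt
    exact (ENNReal.ofReal_lt_ofReal_iff ht0).mp hlt
  obtain ⟨N, hN0, hN⟩ := exists_intCast_mem_differentIdeal (adjoinTower K ξ 0)
  have hNp : ∀ᶠ n in atTop, ¬ (p n : ℤ) ∣ N := by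
    filter_upwards [hmono.tendsto_atTop.eventually_gt_atTop N.natAbs] with n hn hdvd
    exact absurd (Nat.le_of_dvd (Int.natAbs_pos.mpr hN0) (Int.natCast_dvd.mp hdvd)) (by omega)
  obtain ⟨n₀, hn₀⟩ := eventually_atTop.mp ((eventually_le_log_div_sub hmono hd hlim ht hXt).and
    (hNp.and (eventually_ne_of_eventually_lt hmono
      (eventually_lt_of_tendsto_log_div hmono hp hd hlim ht0))))
  refine hX ((finite_setOf_weilHeight_lt (adjoinTower K ξ n₀) X).subset ?_)
  rintro α ⟨hαL, hαX⟩
  refine ⟨?_, hαX⟩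
  classical
  have hex := exists_mem_adjoinTower (hL α hαL)
  have hfind := Nat.find_spec hex
  -- Look at the first level containing `α`: if it lies beyond `n₀`, then `α` is new there and its
  -- height exceeds `X`.
  rcases le_or_gt (Nat.find hex) n₀ with hle | hgt
  · exact monotone_adjoinTower hle hfind
  · obtain ⟨m, hm⟩ : ∃ m, Nat.find hex = m + 1 := ⟨Nat.find hex - 1, by omega⟩
    rw [hm] at hfind
    have hnot : α ∉ adjoinTower K ξ m := Nat.find_min hex (by omega)
    obtain ⟨h1, h2, h3⟩ := hn₀ m (by omega)
    have h4 := log_div_le_weilHeight hp hd hξ hN h2 h3 hfind hnot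
    have h5 : (weilHeight α : ℝ) < X := hαX
    linarith

theorem northcottNumber_integersIn_le (hp : ∀ i, (p i).Prime) (hd : ∀ i, (d i).Prime)
    (hmono : StrictMono p) (hξ : ∀ i, ξ i ^ d i = p i) (ht : 0 ≤ t)
    (hlim : Tendsto (fun i => Real.log (p i) / d i) atTop (𝓝 (2 * t)))
    (hL : ∀ i, ξ i ∈ L) :
    northcottNumber weilHeight (integersIn L) ≤ ENNReal.ofReal (2 * t) := by
  have hinj : Function.Injective ξ := by
    intro i j hij
    have h1 : (p i) ^ d j = (p j) ^ d i := by
      have h : (p i : AlgebraicClosure ℚ) ^ d j = (p j : AlgebraicClosure ℚ) ^ d i := by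
        rw [← hξ i, ← hξ j, hij, ← pow_mul, ← pow_mul, mul_comm]
      exact_mod_cast h
    have h2 : p i ∣ p j := (hp i).dvd_of_dvd_pow (h1 ▸ dvd_pow_self _ (hd j).ne_zero)
    exact hmono.injective ((Nat.prime_dvd_prime_iff_eq (hp i) (hp j)).mp h2)
  refine ENNReal.le_of_forall_pos_le_add fun ε hε _ => ?_
  refine sInf_le ⟨(2 * t).toNNReal + ε, ?_, by simp [ENNReal.ofReal]⟩
  have hlt : 2 * t < (((2 * t).toNNReal + ε : ℝ≥0) : ℝ) := by
    rw [NNReal.coe_add, Real.coe_toNNReal _ (by linarith)]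
    have : (0 : ℝ) < ε := hε
    linarith
  obtain ⟨n₀, hn₀⟩ := eventually_atTop.mp (hlim.eventually_lt_const hlt)
  refine ((Set.Ici_infinite n₀).image hinj.injOn).mono ?_
  rintro _ ⟨i, hi, rfl⟩
  refine ⟨mem_integersIn_of_pow_eq (hL i) (hd i).ne_zero (hξ i), ?_⟩
  have h1 := hn₀ i hi
  rw [← weilHeight_of_pow_eq_natCast (hd i).ne_zero (hp i).ne_zero (hξ i)] at h1
  exact_mod_cast h1

end

/-- Bertrand's postulate gives a prime between `b` and `4 * b`, where `b = d * exp (2 * t * d)`. The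
factors `4` and `d` disappear in the `d`-th root, while `d` forces the primes to infinity even for
`t = 0`. A subsequence makes them strictly increasing. -/
theorem exists_primes_tendsto_rpow (t : ℝ) (ht : 0 ≤ t) :
    ∃ p d : ℕ → ℕ, (∀ i, (p i).Prime) ∧ (∀ i, (d i).Prime) ∧ StrictMono p ∧
      Tendsto (fun i => (p i : ℝ) ^ (1 / (d i : ℝ))) atTop (𝓝 (Real.exp (2 * t))) := by
  let d : ℕ → ℕ := Nat.nth Nat.Prime
  have hd (i) : (d i).Prime := Nat.prime_nth_prime i
  have hdmono : StrictMono d := Nat.nth_strictMono Nat.infinite_setOfPred_prime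
  have hd0 (i) : (0 : ℝ) < d i := by exact_mod_cast (hd i).pos
  have hd1 (i) : (1 : ℝ) ≤ d i := by exact_mod_cast (hd i).one_le
  let b : ℕ → ℝ := fun i => d i * Real.exp (2 * t * d i)
  have hexp (i) : 1 ≤ Real.exp (2 * t * d i) := Real.one_le_exp (by have := hd0 i; positivity)
  have hbd (i) : (d i : ℝ) ≤ b i := le_mul_of_one_le_right (hd0 i).le (hexp i)
  have hb1 (i) : 1 ≤ b i := (hd1 i).trans (hbd i)
  have hex (i) : ∃ q : ℕ, q.Prime ∧ b i ≤ q ∧ (q : ℝ) ≤ 4 * b i := by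
    obtain ⟨q, hq, h1, h2⟩ := Nat.exists_prime_lt_and_le_two_mul ⌈b i⌉₊
      (Nat.ceil_pos.mpr (by have := hb1 i; linarith)).ne'
    refine ⟨q, hq, (Nat.le_ceil _).trans (by exact_mod_cast h1.le), ?_⟩
    have h3 : (q : ℝ) ≤ 2 * (⌈b i⌉₊ : ℝ) := by exact_mod_cast h2
    have h4 := Nat.ceil_lt_add_one (by have := hb1 i; linarith : 0 ≤ b i)
    have := hb1 i
    linarith
  choose q hq hbq hqb using hex
  have hqtop : Tendsto q atTop atTop := tendsto_atTop_mono
    (fun i => by exact_mod_cast (hbd i).trans (hbq i)) hdmono.tendsto_atTop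
  have hdtop : Tendsto (fun i => (d i : ℝ)) atTop atTop :=
    tendsto_natCast_atTop_atTop.comp hdmono.tendsto_atTop
  have hlogb (i) : Real.log (b i) / d i = Real.log (d i) / d i + 2 * t := by
    rw [Real.log_mul (hd0 i).ne' (Real.exp_pos _).ne', Real.log_exp, add_div,
      mul_div_cancel_right₀ _ (hd0 i).ne']
  have hlogd : Tendsto (fun i => Real.log (d i) / d i + 2 * t) atTop (𝓝 (2 * t)) := by
    have := (Real.isLittleO_log_id_atTop.tendsto_div_nhds_zero.comp hdtop).add_const (2 * t)
    rwa [zero_add] at this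
  have hlog : Tendsto (fun i => Real.log (q i) / d i) atTop (𝓝 (2 * t)) := by
    refine tendsto_of_tendsto_of_tendsto_of_le_of_le hlogd
      (h := fun i => Real.log 4 / d i + (Real.log (d i) / d i + 2 * t)) ?_ ?_ ?_
    · have := (tendsto_const_nhds (x := Real.log 4)).div_atTop hdtop |>.add hlogd
      rwa [zero_add] at this
    · intro i
      have := hb1 i
      have := hbq i
      simp only [← hlogb]
      exact div_le_div_of_nonneg_right (Real.log_le_log (by linarith) (by linarith)) (hd0 i).le
    · intro i
      have := hb1 i
      have := hbq i
      simp only [← hlogb]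
      rw [← add_div, ← Real.log_mul (by norm_num) (by linarith)]
      exact div_le_div_of_nonneg_right (Real.log_le_log (by linarith) (hqb i)) (hd0 i).le
  obtain ⟨φ, hφ, hqφ⟩ := strictMono_subseq_of_tendsto_atTop hqtop
  refine ⟨q ∘ φ, d ∘ φ, fun i => hq _, fun i => hd _, hqφ, ?_⟩
  have h1 := ((Real.continuous_exp.tendsto _).comp hlog).comp hφ.tendsto_atTop
  refine h1.congr fun i => ?_
  have : (0 : ℝ) < q (φ i) := by exact_mod_cast (hq _).pos
  simp only [Function.comp_apply]
  rw [Real.rpow_def_of_pos this, mul_one_div]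

end NorthcottNumber

theorem mainTheorem3 (t : ℝ) (ht : 0 ≤ t) :
    (∃ L : IntermediateField ℚ (AlgebraicClosure ℚ),
      ENNReal.ofReal t ≤ northcottNumber weilHeight (L : Set (AlgebraicClosure ℚ)) ∧
      northcottNumber weilHeight (L : Set (AlgebraicClosure ℚ)) ≤
        northcottNumber weilHeight (integersIn L) ∧
      northcottNumber weilHeight (integersIn L) ≤ ENNReal.ofReal (2 * t)) ∧
    (∀ (K : IntermediateField ℚ (AlgebraicClosure ℚ)), FiniteDimensional ℚ K →
      ∀ (p d : ℕ → ℕ) (ξ : ℕ → AlgebraicClosure ℚ),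
        (∀ i, (p i).Prime) → (∀ i, (d i).Prime) → StrictMono p →
        (∀ i, ξ i ^ d i = (p i : AlgebraicClosure ℚ)) →
        Tendsto (fun i => (p i : ℝ) ^ (1 / (d i : ℝ))) atTop (𝓝 (Real.exp (2 * t))) →
        ∀ L : IntermediateField ℚ (AlgebraicClosure ℚ),
          L = (IntermediateField.adjoin K (Set.range ξ)).restrictScalars ℚ →
          ENNReal.ofReal t ≤ northcottNumber weilHeight (L : Set (AlgebraicClosure ℚ)) ∧
          northcottNumber weilHeight (L : Set (AlgebraicClosure ℚ)) ≤
            northcottNumber weilHeight (integersIn L) ∧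
          northcottNumber weilHeight (integersIn L) ≤ ENNReal.ofReal (2 * t)) := by
  have main : ∀ (K : IntermediateField ℚ (AlgebraicClosure ℚ)), FiniteDimensional ℚ K →
      ∀ (p d : ℕ → ℕ) (ξ : ℕ → AlgebraicClosure ℚ),
        (∀ i, (p i).Prime) → (∀ i, (d i).Prime) → StrictMono p →
        (∀ i, ξ i ^ d i = (p i : AlgebraicClosure ℚ)) →
        Tendsto (fun i => (p i : ℝ) ^ (1 / (d i : ℝ))) atTop (𝓝 (Real.exp (2 * t))) →
        ∀ L : IntermediateField ℚ (AlgebraicClosure ℚ),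
          L = (IntermediateField.adjoin K (Set.range ξ)).restrictScalars ℚ →
          ENNReal.ofReal t ≤ northcottNumber weilHeight (L : Set (AlgebraicClosure ℚ)) ∧
          northcottNumber weilHeight (L : Set (AlgebraicClosure ℚ)) ≤
            northcottNumber weilHeight (integersIn L) ∧
          northcottNumber weilHeight (integersIn L) ≤ ENNReal.ofReal (2 * t) := by
    rintro K hK p d ξ hp hd hmono hξ hlim L rfl
    have hlog := tendsto_log_div hp hlim
    exact ⟨le_northcottNumber_adjoin ht hp hd hmono hξ hlog fun _ hx => hx,
      northcottNumber_anti _ (integersIn_subset _),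
      northcottNumber_integersIn_le hp hd hmono hξ ht hlog fun i =>
        IntermediateField.subset_adjoin K (Set.range ξ) ⟨i, rfl⟩⟩
  refine ⟨?_, main⟩
  obtain ⟨p, d, hp, hd, hmono, hlim⟩ := exists_primes_tendsto_rpow t ht
  choose ξ hξ using fun i =>
    IsAlgClosed.exists_pow_nat_eq (p i : AlgebraicClosure ℚ) (hd i).pos
  exact ⟨_, main ⊥ inferInstance p d ξ hp hd hmono hξ hlim _ rfl⟩
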